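/- Let $d\ge 0$ be an integer, $r\in(0,1]$ and $p\in[1,\infty)$. A weight on $\mathbf R^d$ is a function $\omega:\mathbf R^d\to(0,\infty)$ with $\omega,1/\omega\in L^\infty_{loc}(\mathbf R^d)$. For weights $\omega,v$, $\omega$ is called $v$-moderate if there is a constant $c>0$ with $\omega(x+y)\le c\,\omega(x)v(y)$ for all $x,y\in\mathbf R^d$; let $\mathscr P_E(\mathbf R^d)$ be the set of all weights that are $v$-moderate for some weight $v$. For a weight $\omega$, let $L^p_{(\omega)}(\mathbf R^d)$ be the space of measurable $f:\mathbf R^d\to\mathbf C$ with $\|f\cdot\omega\|_{L^p}<\infty$, and let $W\!L^{1,r}_{(\omega)}(\mathbf R^d)$ be the space of measurable $f:\mathbf R^d\to\mathbf C$ with $$ \|f\|_{W\!L^{1,r}_{(\omega)}}=\Big(\sum_{k\in\mathbf Z^d}\big(\|f\|_{L^1(k+[0,1]^d)}\,\omega(k)\big)^r\Big)^{1/r}<\infty , $$ functions being identified when they agree almost everywhere. For function spaces $A,B$ write $A*B=\{f*g: f\in A,\ g\in B\}$, where $(f*g)(x)=\int_{\mathbf R^d}f(y)g(x-y)\,dy$.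 Let $\omega,v\in\mathscr P_E(\mathbf R^d)$ be such that $\omega$ is $v$-moderate. Then for all $f\in W\!L^{1,r}_{(v)}(\mathbf R^d)$ and $g\in L^p_{(\omega)}(\mathbf R^d)$ the integrals defining $(f*g)(x)$ and $(g*f)(x)$ converge absolutely for almost every $x$, and $$ W\!L^{1,r}_{(v)}(\mathbf R^d)*L^p_{(\omega)}(\mathbf R^d)=L^p_{(\omega)}(\mathbf R^d)*W\!L^{1,r}_{(v)}(\mathbf R^d)=L^p_{(\omega)}(\mathbf R^d). $$ Moreover $W\!L^{1,1}_{(v)}(\mathbf R^d)=L^1_{(v)}(\mathbf R^d)$, so that the case $r=1$ is the weighted form of Rudin's identity $L^1*L^p=L^p$, and if $d\ge1$ and $r<1$, then $W\!L^{1,r}_{(v)}(\mathbf R^d)\subsetneq L^1_{(v)}(\mathbf R^d)$, so that the identity is then a strict improvement of Rudin's. -/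

import Mathlib

open MeasureTheory
open scoped ENNReal

/-- `d`-dimensional Euclidean space. -/
abbrev Rd (d : ℕ) : Type := EuclideanSpace ℝ (Fin d)

/-- `u ∈ L^∞_loc(ℝ^d)`: `u` is (Lebesgue) measurable and essentially bounded on every compact
set. -/
def IsLocallyLInfty {d : ℕ} (u : Rd d → ℝ) : Prop :=
  ∀ K : Set (Rd d), IsCompact K → MemLp u ∞ (volume.restrict K)

/-- A weight: a positive function `ω` such that `ω` and `1/ω` belong to `L^∞_loc(ℝ^d)`. -/
structure IsWeight {d : ℕ} (ω : Rd d → ℝ) : Prop where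
  pos : ∀ x, 0 < ω x
  locallyLInfty : IsLocallyLInfty ω
  locallyLInfty_inv : IsLocallyLInfty (fun x => (ω x)⁻¹)

/-- `ω` is `v`-moderate: `ω (x + y) ≲ ω x * v y`, uniformly in `x` and `y`. -/
def IsModerate {d : ℕ} (ω v : Rd d → ℝ) : Prop :=
  ∃ c : ℝ, 0 < c ∧ ∀ x y, ω (x + y) ≤ c * (ω x * v y)

/-- The set of all moderate weights on `ℝ^d`: the weights which are `v`-moderate for some
weight `v`. -/
def ModerateWeights (d : ℕ) : Set (Rd d → ℝ) :=
  {ω | IsWeight ω ∧ ∃ v : Rd d → ℝ, IsWeight v ∧ IsModerate ω v}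

/-- The lattice point `k ∈ ℤ^d`, as an element of `ℝ^d`. -/
def latticePoint {d : ℕ} (k : Fin d → ℤ) : Rd d :=
  WithLp.toLp 2 (fun i => (k i : ℝ))

/-- The closed unit cube `k + Q`, where `Q = [0,1]^d`. -/
def latticeCube {d : ℕ} (k : Fin d → ℤ) : Set (Rd d) :=
  {x | ∀ i, x i ∈ Set.Icc (k i : ℝ) ((k i : ℝ) + 1)}

/-- The Wiener amalgam quasi-norm: the weighted `ℓ^q(ℤ^d)` quasi-norm of
`k ↦ ‖f‖_{L^p(k+Q)}`, the weight entering through its values `ω k`, `k ∈ ℤ^d`. -/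
noncomputable def wienerNorm {d : ℕ} (p q : ℝ≥0∞) (ω : Rd d → ℝ) (f : Rd d → ℂ) : ℝ≥0∞ :=
  eLpNorm (fun k : Fin d → ℤ =>
    eLpNorm f p (volume.restrict (latticeCube k)) * ENNReal.ofReal (ω (latticePoint k)))
    q Measure.count

/-- The Wiener amalgam space `WL^{p,q}_{(ω)}(ℝ^d)`, as a set of functions closed under almost
everywhere equality. -/
def WienerSpace {d : ℕ} (p q : ℝ≥0∞) (ω : Rd d → ℝ) : Set (Rd d → ℂ) :=
  {f | AEStronglyMeasurable f volume ∧ wienerNorm p q ω f < ∞}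

/-- The weighted Lebesgue space `L^p_{(ω)}(ℝ^d)`: the measurable functions `f` with
`‖f ω‖_{L^p} < ∞`, as a set of functions closed under almost everywhere equality. -/
def WeightedLp {d : ℕ} (p : ℝ≥0∞) (ω : Rd d → ℝ) : Set (Rd d → ℂ) :=
  {f | AEStronglyMeasurable f volume ∧ eLpNorm (fun x => f x * (ω x : ℂ)) p volume < ∞}

/-- `(f * g) x` is given by an absolutely convergent integral `∫ f y * g (x - y) dy`. -/
def ConvDefinedAt {d : ℕ} (f g : Rd d → ℂ) (x : Rd d) : Prop :=
  ConvolutionExistsAt f g x (ContinuousLinearMap.mul ℂ ℂ) volume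

/-- The convolution `(f * g) x = ∫ f y * g (x - y) dy`. -/
noncomputable def conv {d : ℕ} (f g : Rd d → ℂ) : Rd d → ℂ :=
  convolution f g (ContinuousLinearMap.mul ℂ ℂ) volume

/-- `A * B = {f * g : f ∈ A, g ∈ B}`, functions being identified when they agree almost
everywhere. -/
def convSet {d : ℕ} (A B : Set (Rd d → ℂ)) : Set (Rd d → ℂ) :=
  {h | ∃ f ∈ A, ∃ g ∈ B, h =ᵐ[volume] conv f g}

/-!
# Convolution factorization of `L^p_{(ω)}` through Wiener amalgam spaces

The convolution integrals and the inclusions into `L^p_{(ω)}` follow from a weighted Young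
inequality: moderateness gives `ω x |f y| |g (x - y)| ≤ c (|f y| v y) (|g (x - y)| ω (x - y))`, so
the unweighted estimate `‖F * G‖_p ≤ ‖F‖_1 ‖G‖_p` applies (`eLpNorm_conv_le`,
`ae_convDefinedAt`).

The substance is that every `h ∈ L^p_{(ω)}` equals `f * g` with `g ∈ L^p_{(ω)}` and `f` an
`L^1_{(v)}` function supported in the closed unit ball (`exists_eq_conv`). Such an `f` meets only
finitely many unit cubes, hence lies in `WL^{1,r}_{(v)}` for every `r > 0`
(`mem_wienerSpace_of_ae_eq_zero`); this is why the exponent `r` plays no role. The factorization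
uses a product form of Cohen's method (`exists_bilinear_apply_eq`). Let `T_n` be convolution with
`((1 - a) δ + a φ_1) * ⋯ * ((1 - a) δ + a φ_n) = (1 - a) ^ n δ + f_n`, where the `φ_k` are
mollifiers whose radii sum to at most `1`. Convolution with mollifiers is uniformly bounded on
`L^p_{(ω)}`, so for small `a` each factor is invertible there, and the `T_n⁻¹ h` converge when
every `φ_{n+1}` acts almost as the identity on `T_n⁻¹ h`. When it does so on `f_n` as well, the
`f_n` converge in `L^1_{(v)}`, and `h = (1 - a) ^ n T_n⁻¹ h + f_n * T_n⁻¹ h` becomes `h = f * g`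
in the limit.

A moderate weight is comparable on each unit cube to its value at the lattice point, uniformly in
the cube (`exists_ae_weight_le`); this gives `WL^{1,1}_{(v)} = L^1_{(v)}`. The inclusion of
`WL^{1,r}_{(v)}` for `r < 1` is `ℓ^r ⊆ ℓ^1`, and it is strict because the step function
with value `b k / v k` on the cube of `k` has amalgam quasi-norm `‖b‖_{ℓ^r}`.
-/

/-! ### Factorization through a bounded bilinear action -/

section Factorization

variable {A X : Type*} [NormedAddCommGroup A] [NormedSpace ℂ A] [CompleteSpace A]
  [NormedAddCommGroup X] [NormedSpace ℂ X] [CompleteSpace X]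

/-- If `E` is bounded and `a` is small, then `(1 - a) • I + a • E` is invertible, and its inverse
moves `g` no further than `E` does. -/
theorem exists_smul_add_smul_apply_eq (E : X →L[ℂ] X) {a C : ℝ} (ha : 0 < a) (ha' : a ≤ 1 / 4)
    (hE : ‖E‖ ≤ C) (haC : a * C ≤ 1 / 4) (g : X) :
    ∃ g' : X, ((1 - a : ℝ) : ℂ) • g' + (a : ℂ) • E g' = g ∧ ‖g' - g‖ ≤ ‖E g - g‖ := by
  -- a Neumann series: `(1 - a) • I + a • E = 1 - D` with `‖D‖ ≤ 1 / 2`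
  set D : X →L[ℂ] X := (a : ℂ) • (1 - E) with hD
  have hnE : a * ‖E‖ ≤ 1 / 4 := (mul_le_mul_of_nonneg_left hE ha.le).trans haC
  have hDx : ∀ x, ‖D x‖ ≤ 1 / 2 * ‖x‖ := by
    intro x
    have h1 : ‖D x‖ = a * ‖x - E x‖ := by
      simp [hD, norm_smul, abs_of_pos ha]
    have h2 : ‖x - E x‖ ≤ ‖x‖ + ‖E‖ * ‖x‖ :=
      (norm_sub_le _ _).trans (by gcongr; exact E.le_opNorm x)
    rw [h1]
    nlinarith [norm_nonneg x, mul_le_mul_of_nonneg_left h2 ha.le,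
      mul_le_mul_of_nonneg_right hnE (norm_nonneg x),
      mul_le_mul_of_nonneg_right ha' (norm_nonneg x)]
  have hDn : ‖D‖ < 1 :=
    (D.opNorm_le_bound (by norm_num) hDx).trans_lt (by norm_num)
  obtain ⟨u, hu⟩ := isUnit_one_sub_of_norm_lt_one hDn
  have hS : ∀ x, ((1 - a : ℝ) : ℂ) • x + (a : ℂ) • E x = (u : X →L[ℂ] X) x := by
    intro x
    rw [hu]
    simp only [hD, _root_.sub_apply, _root_.smul_apply,
      one_apply_eq_self, Complex.ofReal_sub, Complex.ofReal_one]
    module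
  have hinv : (u : X →L[ℂ] X) ((↑u⁻¹ : X →L[ℂ] X) g) = g := by
    rw [← mul_apply_eq_comp, Units.mul_inv, one_apply_eq_self]
  refine ⟨(↑u⁻¹ : X →L[ℂ] X) g, by rw [hS, hinv], ?_⟩
  -- `g' - g = D (g' - g) + D g`, and `D` at most halves norms
  set g' : X := (↑u⁻¹ : X →L[ℂ] X) g
  have h1 : g' - g = D (g' - g) + D g := by
    have : g' - D g' = g := by
      have h := hinv
      rw [hu] at h
      simpa using h
    rw [map_sub, sub_add_cancel]
    nth_rewrite 1 [← this]
    abel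
  have h2 : ‖D g‖ ≤ 1 / 4 * ‖E g - g‖ := by
    have : ‖D g‖ = a * ‖E g - g‖ := by
      rw [norm_sub_rev]; simp [hD, norm_smul, abs_of_pos ha]
    rw [this]; gcongr
  have h3 : ‖g' - g‖ ≤ ‖D (g' - g)‖ + ‖D g‖ := by
    nth_rewrite 1 [h1]; exact norm_add_le _ _
  have h4 := hDx (g' - g)
  have h5 := norm_nonneg (E g - g)
  linarith

/-- **Factorization theorem** of Cohen type. Let `B` be a bounded bilinear action of `A` on `X`,
and `V 0 ≤ V 1 ≤ ⋯` subspaces of `A` such that at every stage there are elements `φ` of the next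
subspace, of uniformly bounded size, which act almost as the identity both on a given `G : X` and
(from the right) on a given `F ∈ V n`. Then every `h : X` is of the form `B F G` with `F` in the
closure of the subspaces. -/
theorem exists_bilinear_apply_eq (B : A →L[ℂ] X →L[ℂ] X) (V : ℕ → Submodule ℂ A)
    (hV : ∀ n, V n ≤ V (n + 1)) (C : ℝ)
    (H : ∀ n, ∀ F ∈ V n, ∀ G : X, ∀ ε > 0, ∃ φ ∈ V (n + 1), ∃ F' ∈ V (n + 1),
      ‖φ‖ ≤ C ∧ ‖B φ‖ ≤ C ∧ ‖F' - F‖ ≤ ε ∧ ‖B φ G - G‖ ≤ ε ∧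
      ∀ G', B F' G' = B F (B φ G')) (h : X) :
    ∃ F ∈ closure (⋃ n, (V n : Set A)), ∃ G, B F G = h := by
  obtain ⟨a, ha, ha', haC⟩ : ∃ a : ℝ, 0 < a ∧ a ≤ 1 / 4 ∧ a * C ≤ 1 / 4 := by
    refine ⟨1 / (4 * (1 + |C|)), by positivity, ?_, ?_⟩
    · rw [div_le_div_iff₀ (by positivity) (by norm_num)]; linarith [abs_nonneg C]
    · rw [div_mul_eq_mul_div, div_le_div_iff₀ (by positivity) (by norm_num)]
      linarith [le_abs_self C, abs_nonneg C]
  -- The states of the construction: `h = T_n G` with `T_n = (1 - a) ^ n • I + B F`. A step replaces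
  -- `T_n` by its product with `(1 - a) • I + a • B φ`.
  let P : ℕ → A × X → Prop := fun n s =>
    s.1 ∈ V n ∧ h = (((1 - a) ^ n : ℝ) : ℂ) • s.2 + B s.1 s.2
  have step : ∀ n s, P n s → ∃ s', P (n + 1) s' ∧
      ‖s'.1 - s.1‖ ≤ (1 + C) * (1 - a) ^ n ∧ ‖s'.2 - s.2‖ ≤ 1 * (1 - a) ^ n := by
    rintro n ⟨F, G⟩ ⟨hF, hh⟩
    -- the error `(1 - a) ^ n` makes both sequences Cauchy at the geometric rate `1 - a`
    obtain ⟨φ, hφ, F', hF', hφC, hBC, hFF, hGG, hass⟩ :=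
      H n F hF G ((1 - a) ^ n) (pow_pos (by linarith) n)
    obtain ⟨G', hG', hGd⟩ := exists_smul_add_smul_apply_eq (B φ) ha ha' hBC haC G
    have hpow : 0 < (1 - a) ^ n := pow_pos (by linarith) n
    refine ⟨(((1 - a : ℝ) : ℂ) • F + (a : ℂ) • F' + (((1 - a) ^ n * a : ℝ) : ℂ) • φ, G'),
      ⟨?_, ?_⟩, ?_, ?_⟩
    · exact add_mem (add_mem ((V _).smul_mem _ (hV n hF)) ((V _).smul_mem _ hF'))
        ((V _).smul_mem _ hφ)
    · simp only at hh ⊢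
      rw [hh]
      nth_rewrite 1 [← hG']
      nth_rewrite 1 [← hG']
      simp only [map_add, map_smul, _root_.add_apply, _root_.smul_apply,
        hass]
      push_cast
      module
    · have e : ((1 - a : ℝ) : ℂ) • F + (a : ℂ) • F' + (((1 - a) ^ n * a : ℝ) : ℂ) • φ - F
          = (a : ℂ) • (F' - F) + (((1 - a) ^ n * a : ℝ) : ℂ) • φ := by
        push_cast; module
      simp only [e]
      refine (norm_add_le _ _).trans ?_
      rw [norm_smul, norm_smul, Complex.norm_real, Complex.norm_real, Real.norm_of_nonneg ha.le,
        Real.norm_of_nonneg (by positivity)]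
      have h1 : a * ‖F' - F‖ ≤ 1 * (1 - a) ^ n := by gcongr; linarith
      have hC0 : 0 ≤ C := (norm_nonneg _).trans hφC
      have h2 : (1 - a) ^ n * a * ‖φ‖ ≤ (1 - a) ^ n * 1 * C := by gcongr; linarith
      linarith
    · exact (hGd.trans hGG).trans_eq (one_mul _).symm
  have h0 : P 0 (0, h) := ⟨(V 0).zero_mem, by simp⟩
  choose! f hf using step
  let s : ℕ → A × X := fun n => Nat.rec (0, h) (fun n s => f n s) n
  have hs : ∀ n, P n (s n) := by
    intro n
    induction n with
    | zero => exact h0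
    | succ n ih => exact (hf n _ ih).1
  have hr : 1 - a < 1 := by linarith
  have c1 : CauchySeq fun n => (s n).1 :=
    cauchySeq_of_le_geometric (1 - a) (1 + C) hr fun n => by
      rw [dist_comm, dist_eq_norm]; exact (hf n _ (hs n)).2.1
  have c2 : CauchySeq fun n => (s n).2 :=
    cauchySeq_of_le_geometric (1 - a) 1 hr fun n => by
      rw [dist_comm, dist_eq_norm]; exact (hf n _ (hs n)).2.2
  obtain ⟨F, hF⟩ := cauchySeq_tendsto_of_complete c1
  obtain ⟨G, hG⟩ := cauchySeq_tendsto_of_complete c2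
  refine ⟨F, mem_closure_of_tendsto hF (Filter.Eventually.of_forall fun n =>
    Set.mem_iUnion.2 ⟨n, (hs n).1⟩), G, ?_⟩
  have l1 : Filter.Tendsto (fun n => B (s n).1 (s n).2) Filter.atTop (nhds (B F G)) :=
    (B.continuous₂.tendsto (F, G)).comp (hF.prodMk_nhds hG)
  have l2 : Filter.Tendsto (fun n : ℕ => (((1 - a) ^ n : ℝ) : ℂ) • (s n).2) Filter.atTop
      (nhds 0) := by
    have := (Complex.continuous_ofReal.tendsto _).comp
      (tendsto_pow_atTop_nhds_zero_of_lt_one (by linarith : 0 ≤ 1 - a) hr)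
    simpa using this.smul hG
  have l3 := l2.add l1
  rw [zero_add] at l3
  refine tendsto_nhds_unique l3 (tendsto_const_nhds.congr fun n => (hs n).2)

end Factorization

/-! ### Weighted Lebesgue measures -/

/-- The measure `ω ^ p dx`, whose `L^p` space is `L^p_{(ω)}`. -/
noncomputable def weightedMeasure {d : ℕ} (p : ℝ≥0∞) (ω : Rd d → ℝ) : Measure (Rd d) :=
  volume.withDensity fun x => ENNReal.ofReal (ω x) ^ p.toReal

section Weights

variable {d : ℕ} {p : ℝ≥0∞} {ω v : Rd d → ℝ}

theorem IsLocallyLInfty.aestronglyMeasurable {u : Rd d → ℝ} (hu : IsLocallyLInfty u) :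
    AEStronglyMeasurable u volume := by
  rw [← Measure.restrict_univ (μ := (volume : Measure (Rd d))),
    ← Metric.iUnion_closedBall_nat (0 : Rd d), aestronglyMeasurable_iUnion_iff]
  exact fun n => (hu _ (isCompact_closedBall 0 (n : ℝ))).aestronglyMeasurable

theorem IsLocallyLInfty.exists_ae_norm_le {u : Rd d → ℝ} (hu : IsLocallyLInfty u)
    {K : Set (Rd d)} (hK : IsCompact K) :
    ∃ M : ℝ, 0 < M ∧ ∀ᵐ x ∂volume, x ∈ K → |u x| ≤ M := by
  have h := hu K hK
  obtain ⟨M, hM⟩ := (ENNReal.lt_iff_exists_real_btwn.1 h.eLpNorm_lt_top)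
  refine ⟨max M 1, by positivity, ?_⟩
  rw [← ae_restrict_iff' hK.measurableSet]
  have h2 := ae_le_eLpNormEssSup (f := u) (μ := volume.restrict K)
  filter_upwards [h2] with x hx
  rw [eLpNorm_exponent_top] at hM
  have h3 := hx.trans hM.2.1.le
  rw [Real.enorm_eq_ofReal_abs] at h3
  exact ((ENNReal.ofReal_le_ofReal_iff hM.1).1 h3).trans (le_max_left _ _)

namespace IsWeight

theorem aemeasurable_ofReal (hω : IsWeight ω) :
    AEMeasurable (fun x => ENNReal.ofReal (ω x)) volume :=
  hω.locallyLInfty.aestronglyMeasurable.aemeasurable.ennreal_ofReal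

theorem aestronglyMeasurable_ofReal (hω : IsWeight ω) :
    AEStronglyMeasurable (fun x => (ω x : ℂ)) volume :=
  Complex.continuous_ofReal.comp_aestronglyMeasurable hω.locallyLInfty.aestronglyMeasurable

theorem lintegral_weightedMeasure (hω : IsWeight ω) (F : Rd d → ℝ≥0∞) :
    ∫⁻ x, F x ∂weightedMeasure p ω = ∫⁻ x, ENNReal.ofReal (ω x) ^ p.toReal * F x := by
  rw [weightedMeasure, lintegral_withDensity_eq_lintegral_mul_non_measurable₀ _
    (hω.aemeasurable_ofReal.pow_const _)
    (Filter.Eventually.of_forall fun x =>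
      ENNReal.rpow_lt_top_of_nonneg ENNReal.toReal_nonneg ENNReal.ofReal_ne_top)]
  rfl

theorem weightedMeasure_absolutelyContinuous : weightedMeasure p ω ≪ volume :=
  withDensity_absolutelyContinuous _ _

theorem absolutelyContinuous_weightedMeasure (hω : IsWeight ω) :
    (volume : Measure (Rd d)) ≪ weightedMeasure p ω :=
  withDensity_absolutelyContinuous' (hω.aemeasurable_ofReal.pow_const _)
    (Filter.Eventually.of_forall fun x =>
      (ENNReal.rpow_pos (ENNReal.ofReal_pos.2 (hω.pos x)) ENNReal.ofReal_ne_top).ne')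

theorem ae_weightedMeasure (hω : IsWeight ω) : ae (weightedMeasure p ω) = ae volume :=
  le_antisymm weightedMeasure_absolutelyContinuous.ae_le
    hω.absolutelyContinuous_weightedMeasure.ae_le

theorem aestronglyMeasurable_weightedMeasure_iff (hω : IsWeight ω) {f : Rd d → ℂ} :
    AEStronglyMeasurable f (weightedMeasure p ω) ↔ AEStronglyMeasurable f volume :=
  ⟨fun h => h.mono_ac hω.absolutelyContinuous_weightedMeasure,
    fun h => h.mono_ac weightedMeasure_absolutelyContinuous⟩

theorem eLpNorm_weightedMeasure (hω : IsWeight ω) (hp0 : p ≠ 0) (hp : p ≠ ∞) (f : Rd d → ℂ) :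
    eLpNorm f p (weightedMeasure p ω) = eLpNorm (fun x => f x * (ω x : ℂ)) p volume := by
  rw [eLpNorm_eq_lintegral_rpow_enorm_toReal hp0 hp, eLpNorm_eq_lintegral_rpow_enorm_toReal hp0 hp,
    hω.lintegral_weightedMeasure]
  congr 2 with x
  rw [enorm_mul, ENNReal.mul_rpow_of_nonneg _ _ ENNReal.toReal_nonneg, mul_comm,
    ← ofReal_norm (ω x : ℂ), Complex.norm_real, Real.norm_of_nonneg (hω.pos x).le]

theorem mem_weightedLp_iff (hω : IsWeight ω) (hp0 : p ≠ 0) (hp : p ≠ ∞) {f : Rd d → ℂ} :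
    f ∈ WeightedLp p ω ↔ MemLp f p (weightedMeasure p ω) := by
  rw [MemLp, hω.aestronglyMeasurable_weightedMeasure_iff, hω.eLpNorm_weightedMeasure hp0 hp]
  rfl

theorem eLpNorm_one_weightedMeasure (hω : IsWeight ω) (f : Rd d → ℂ) :
    eLpNorm f 1 (weightedMeasure 1 ω) = ∫⁻ x, ‖f x‖ₑ * ENNReal.ofReal (ω x) := by
  rw [eLpNorm_one_eq_lintegral_enorm, hω.lintegral_weightedMeasure]
  simp [mul_comm]

theorem isLocallyFiniteMeasure_weightedMeasure (hω : IsWeight ω) :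
    IsLocallyFiniteMeasure (weightedMeasure p ω) := by
  refine ⟨fun x => ⟨Metric.closedBall x 1, Metric.closedBall_mem_nhds x one_pos, ?_⟩⟩
  obtain ⟨M, hM, h⟩ := hω.locallyLInfty.exists_ae_norm_le (isCompact_closedBall x 1)
  rw [weightedMeasure, withDensity_apply _ measurableSet_closedBall]
  calc ∫⁻ y in Metric.closedBall x 1, ENNReal.ofReal (ω y) ^ p.toReal
      ≤ ∫⁻ y in Metric.closedBall x 1, ENNReal.ofReal M ^ p.toReal := by
        refine setLIntegral_mono_ae' measurableSet_closedBall ?_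
        filter_upwards [h] with y hy hyx
        exact ENNReal.rpow_le_rpow (ENNReal.ofReal_le_ofReal ((le_abs_self _).trans (hy hyx)))
          ENNReal.toReal_nonneg
    _ < ∞ := by
        rw [setLIntegral_const]
        exact ENNReal.mul_lt_top (ENNReal.rpow_lt_top_of_nonneg ENNReal.toReal_nonneg
          ENNReal.ofReal_ne_top) (isCompact_closedBall x 1).measure_lt_top

theorem locallyIntegrable_of_memLp (hω : IsWeight ω) (hp1 : 1 ≤ p) (hp : p ≠ ∞) {f : Rd d → ℂ}
    (hf : MemLp f p (weightedMeasure p ω)) : LocallyIntegrable f volume := by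
  rw [locallyIntegrable_iff]
  intro K hK
  have : Fact (volume K < ∞) := ⟨hK.measure_lt_top⟩
  have hp0 : p ≠ 0 := (one_pos.trans_le hp1).ne'
  have h1 : MemLp (fun x => f x * (ω x : ℂ)) p volume :=
    ⟨((hω.aestronglyMeasurable_weightedMeasure_iff).1 hf.1).mul hω.aestronglyMeasurable_ofReal,
      (hω.eLpNorm_weightedMeasure hp0 hp f) ▸ hf.2⟩
  have h2 : MemLp (fun x => f x * (ω x : ℂ)) 1 (volume.restrict K) :=
    (h1.restrict K).mono_exponent hp1
  have h3 : MemLp (fun x => ((ω x)⁻¹ : ℂ)) ∞ (volume.restrict K) := by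
    have := (hω.locallyLInfty_inv K hK).ofReal (K := ℂ)
    simpa using this
  have h4 : MemLp (fun x => ((ω x)⁻¹ : ℂ) * (f x * (ω x : ℂ))) 1 (volume.restrict K) :=
    h2.mul' h3
  rw [IntegrableOn, ← memLp_one_iff_integrable]
  refine h4.congr_norm ?_ (Filter.Eventually.of_forall fun x => ?_)
  · exact ((hω.aestronglyMeasurable_weightedMeasure_iff).1 hf.1).restrict
  · have : (ω x : ℂ) ≠ 0 := Complex.ofReal_ne_zero.2 (hω.pos x).ne'
    congr 1; field_simp

end IsWeight

end Weights

/-! ### The weighted Young inequality -/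

section Young

variable {d : ℕ} {p : ℝ≥0∞} {ω v : Rd d → ℝ}

theorem aemeasurable_comp_sub_left {G : Rd d → ℝ≥0∞} (hG : AEMeasurable G volume) (x : Rd d) :
    AEMeasurable (fun y => G (x - y)) volume :=
  hG.comp_quasiMeasurePreserving (quasiMeasurePreserving_sub_left_of_right_invariant volume x)

theorem aemeasurable_conv_integrand {F G : Rd d → ℝ≥0∞} (hF : AEMeasurable F volume)
    (hG : AEMeasurable G volume) :
    AEMeasurable (fun z : Rd d × Rd d => F z.2 * G (z.1 - z.2)) (volume.prod volume) :=
  hF.comp_snd.mul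
    (hG.comp_quasiMeasurePreserving (quasiMeasurePreserving_sub_of_right_invariant volume volume))

/-- Young's inequality `‖F * G‖_q ≤ ‖F‖_1 ‖G‖_q` for `[0, ∞]`-valued functions. -/
theorem lintegral_rpow_lintegral_mul_sub_le {F G : Rd d → ℝ≥0∞} (hF : AEMeasurable F volume)
    (hG : AEMeasurable G volume) {q : ℝ} (hq : 1 ≤ q) :
    ∫⁻ x, (∫⁻ y, F y * G (x - y)) ^ q ≤ (∫⁻ x, F x) ^ q * ∫⁻ x, G x ^ q := by
  have hq0 : 0 < q := by linarith
  have hqi : 0 ≤ 1 - q⁻¹ := sub_nonneg.2 (inv_le_one_of_one_le₀ hq)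
  have hqi' : 0 ≤ q⁻¹ := inv_nonneg.2 hq0.le
  -- Hölder's inequality with respect to the measure `F y dy`; the factors `F` and `F * G ^ q`
  -- with exponents `1 - 1 / q` and `1 / q` include the case `q = 1`
  have key : ∀ x, (∫⁻ y, F y * G (x - y)) ^ q ≤
      (∫⁻ y, F y) ^ (q - 1) * ∫⁻ y, F y * G (x - y) ^ q := by
    intro x
    have hGx := (aemeasurable_comp_sub_left hG x).pow_const q
    have h := ENNReal.lintegral_mul_norm_pow_le hF (hF.mul hGx) hqi hqi' (by ring)
    have e : ∀ y, F y ^ (1 - q⁻¹) * (F * fun y => G (x - y) ^ q) y ^ q⁻¹ = F y * G (x - y) := by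
      intro y
      rw [Pi.mul_apply, ENNReal.mul_rpow_of_nonneg _ _ hqi', ← mul_assoc,
        ← ENNReal.rpow_add_of_nonneg _ _ hqi hqi', ← ENNReal.rpow_mul,
        mul_inv_cancel₀ hq0.ne']
      simp
    simp_rw [e] at h
    refine (ENNReal.rpow_le_rpow h hq0.le).trans_eq ?_
    rw [ENNReal.mul_rpow_of_nonneg _ _ hq0.le, ← ENNReal.rpow_mul, ← ENNReal.rpow_mul,
      inv_mul_cancel₀ hq0.ne', ENNReal.rpow_one, sub_mul, inv_mul_cancel₀ hq0.ne', one_mul]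
    rfl
  have hm := aemeasurable_conv_integrand hF (hG.pow_const q)
  calc ∫⁻ x, (∫⁻ y, F y * G (x - y)) ^ q
      ≤ ∫⁻ x, (∫⁻ y, F y) ^ (q - 1) * ∫⁻ y, F y * G (x - y) ^ q := lintegral_mono key
    _ = (∫⁻ y, F y) ^ (q - 1) * ∫⁻ x, ∫⁻ y, F y * G (x - y) ^ q :=
        lintegral_const_mul'' _ hm.lintegral_prod_right'
    _ = (∫⁻ y, F y) ^ (q - 1) * ∫⁻ y, ∫⁻ x, F y * G (x - y) ^ q := by
        rw [lintegral_lintegral_swap hm]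
    _ = (∫⁻ y, F y) ^ (q - 1) * ∫⁻ y, F y * ∫⁻ x, G x ^ q := by
        congr 2 with y
        have hGy : AEMeasurable (fun x => G (x - y) ^ q) volume :=
          (hG.pow_const q).comp_quasiMeasurePreserving
            (measurePreserving_sub_right volume y).quasiMeasurePreserving
        rw [lintegral_const_mul'' _ hGy,
          lintegral_sub_right_eq_self (fun x => G x ^ q) y]
    _ = (∫⁻ x, F x) ^ q * ∫⁻ x, G x ^ q := by
        rw [lintegral_mul_const'' _ hF, ← mul_assoc]
        congr 1
        nth_rewrite 2 [← ENNReal.rpow_one (∫⁻ y, F y)]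
        rw [← ENNReal.rpow_add_of_nonneg _ _ (by linarith) zero_le_one]
        congr 1; ring

theorem ofReal_mul_lintegral_le {c : ℝ} (hc : 0 < c) (hω : IsWeight ω)
    (hmod : ∀ x y, ω (x + y) ≤ c * (ω x * v y)) (f g : Rd d → ℂ) (x : Rd d) :
    ENNReal.ofReal (ω x) * ∫⁻ y, ‖f y‖ₑ * ‖g (x - y)‖ₑ ≤
      ENNReal.ofReal c * ∫⁻ y, (‖f y‖ₑ * ENNReal.ofReal (v y)) *
        (‖g (x - y)‖ₑ * ENNReal.ofReal (ω (x - y))) := by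
  rw [← lintegral_const_mul' _ _ ENNReal.ofReal_ne_top,
    ← lintegral_const_mul' _ _ ENNReal.ofReal_ne_top]
  refine lintegral_mono fun y => ?_
  have h := hmod (x - y) y
  rw [sub_add_cancel] at h
  have h2 : ENNReal.ofReal (ω x) ≤
      ENNReal.ofReal c * (ENNReal.ofReal (ω (x - y)) * ENNReal.ofReal (v y)) := by
    rw [← ENNReal.ofReal_mul (hω.pos _).le, ← ENNReal.ofReal_mul hc.le]
    exact ENNReal.ofReal_le_ofReal h
  calc ENNReal.ofReal (ω x) * (‖f y‖ₑ * ‖g (x - y)‖ₑ)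
      ≤ ENNReal.ofReal c * (ENNReal.ofReal (ω (x - y)) * ENNReal.ofReal (v y)) *
        (‖f y‖ₑ * ‖g (x - y)‖ₑ) := by gcongr
    _ = _ := by ring

/-- The weighted Young inequality for the absolutely convergent convolution. -/
theorem lintegral_rpow_weight_mul_le {c : ℝ} (hc : 0 < c) (hω : IsWeight ω) (hv : IsWeight v)
    (hmod : ∀ x y, ω (x + y) ≤ c * (ω x * v y)) (hp1 : 1 ≤ p) (hp : p ≠ ∞) {f g : Rd d → ℂ}
    (hf : AEStronglyMeasurable f volume) (hg : AEStronglyMeasurable g volume) :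
    (∫⁻ x, (ENNReal.ofReal (ω x) * ∫⁻ y, ‖f y‖ₑ * ‖g (x - y)‖ₑ) ^ p.toReal) ^ (1 / p.toReal) ≤
      ENNReal.ofReal c * (eLpNorm f 1 (weightedMeasure 1 v) *
        eLpNorm g p (weightedMeasure p ω)) := by
  have hp0 : p ≠ 0 := (one_pos.trans_le hp1).ne'
  have hq : 1 ≤ p.toReal := by
    rw [← ENNReal.toReal_one]; exact ENNReal.toReal_mono hp hp1
  have hq0 : 0 < p.toReal := by linarith
  have hF : AEMeasurable (fun y => ‖f y‖ₑ * ENNReal.ofReal (v y)) volume :=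
    hf.enorm.mul hv.aemeasurable_ofReal
  have hG : AEMeasurable (fun y => ‖g y‖ₑ * ENNReal.ofReal (ω y)) volume :=
    hg.enorm.mul hω.aemeasurable_ofReal
  have h1 : ∫⁻ x, (ENNReal.ofReal (ω x) * ∫⁻ y, ‖f y‖ₑ * ‖g (x - y)‖ₑ) ^ p.toReal ≤
      ENNReal.ofReal c ^ p.toReal * ((∫⁻ y, ‖f y‖ₑ * ENNReal.ofReal (v y)) ^ p.toReal *
        ∫⁻ y, (‖g y‖ₑ * ENNReal.ofReal (ω y)) ^ p.toReal) := by
    refine le_trans ?_ (mul_le_mul_right (lintegral_rpow_lintegral_mul_sub_le hF hG hq) _)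
    rw [← lintegral_const_mul' _ _
      (ENNReal.rpow_lt_top_of_nonneg hq0.le ENNReal.ofReal_ne_top).ne]
    refine lintegral_mono fun x => ?_
    rw [← ENNReal.mul_rpow_of_nonneg _ _ hq0.le]
    exact ENNReal.rpow_le_rpow (ofReal_mul_lintegral_le hc hω hmod f g x) hq0.le
  have h2 := ENNReal.rpow_le_rpow h1 (one_div_nonneg.2 hq0.le)
  refine h2.trans_eq ?_
  rw [ENNReal.mul_rpow_of_nonneg _ _ (one_div_nonneg.2 hq0.le),
    ENNReal.mul_rpow_of_nonneg _ _ (one_div_nonneg.2 hq0.le), ← ENNReal.rpow_mul,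
    ← ENNReal.rpow_mul, mul_one_div_cancel hq0.ne', ENNReal.rpow_one, ENNReal.rpow_one,
    hv.eLpNorm_one_weightedMeasure, eLpNorm_eq_lintegral_rpow_enorm_toReal hp0 hp,
    hω.lintegral_weightedMeasure]
  congr 4 with x
  rw [ENNReal.mul_rpow_of_nonneg _ _ hq0.le, mul_comm]

theorem aestronglyMeasurable_conv {f g : Rd d → ℂ} (hf : AEStronglyMeasurable f volume)
    (hg : AEStronglyMeasurable g volume) : AEStronglyMeasurable (conv f g) volume :=
  (hf.convolution_integrand (ContinuousLinearMap.mul ℂ ℂ) hg).integral_prod_right'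

/-- The weighted Young inequality: if `ω` is `v`-moderate, then
`‖f * g‖_{L^p_{(ω)}} ≤ c ‖f‖_{L^1_{(v)}} ‖g‖_{L^p_{(ω)}}`. -/
theorem eLpNorm_conv_le {c : ℝ} (hc : 0 < c) (hω : IsWeight ω) (hv : IsWeight v)
    (hmod : ∀ x y, ω (x + y) ≤ c * (ω x * v y)) (hp1 : 1 ≤ p) (hp : p ≠ ∞) {f g : Rd d → ℂ}
    (hf : AEStronglyMeasurable f volume) (hg : AEStronglyMeasurable g volume) :
    eLpNorm (conv f g) p (weightedMeasure p ω) ≤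
      ENNReal.ofReal c * (eLpNorm f 1 (weightedMeasure 1 v) *
        eLpNorm g p (weightedMeasure p ω)) := by
  have hp0 : p ≠ 0 := (one_pos.trans_le hp1).ne'
  refine le_trans ?_ (lintegral_rpow_weight_mul_le hc hω hv hmod hp1 hp hf hg)
  rw [eLpNorm_eq_lintegral_rpow_enorm_toReal hp0 hp, hω.lintegral_weightedMeasure]
  gcongr with x
  rw [ENNReal.mul_rpow_of_nonneg _ _ ENNReal.toReal_nonneg]
  gcongr
  refine (enorm_integral_le_lintegral_enorm _).trans_eq ?_
  simp [enorm_mul]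

theorem memLp_conv {c : ℝ} (hc : 0 < c) (hω : IsWeight ω) (hv : IsWeight v)
    (hmod : ∀ x y, ω (x + y) ≤ c * (ω x * v y)) (hp1 : 1 ≤ p) (hp : p ≠ ∞) {f g : Rd d → ℂ}
    (hf : MemLp f 1 (weightedMeasure 1 v)) (hg : MemLp g p (weightedMeasure p ω)) :
    MemLp (conv f g) p (weightedMeasure p ω) := by
  have hf' := hv.aestronglyMeasurable_weightedMeasure_iff.1 hf.1
  have hg' := hω.aestronglyMeasurable_weightedMeasure_iff.1 hg.1
  exact ⟨hω.aestronglyMeasurable_weightedMeasure_iff.2 (aestronglyMeasurable_conv hf' hg'),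
    (eLpNorm_conv_le hc hω hv hmod hp1 hp hf' hg').trans_lt
      (ENNReal.mul_lt_top ENNReal.ofReal_lt_top (ENNReal.mul_lt_top hf.2 hg.2))⟩

theorem convDefinedAt_comm {f g : Rd d → ℂ} {x : Rd d} :
    ConvDefinedAt f g x ↔ ConvDefinedAt g f x := by
  have h := convolutionExistsAt_flip (f := f) (g := g) (x := x)
    (L := ContinuousLinearMap.mul ℂ ℂ) (μ := (volume : Measure (Rd d)))
  rw [ContinuousLinearMap.flip_mul] at h
  exact h.symm

theorem conv_comm (f g : Rd d → ℂ) : conv f g = conv g f := by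
  have h := convolution_flip (f := g) (g := f)
    (L := ContinuousLinearMap.mul ℂ ℂ) (μ := (volume : Measure (Rd d)))
  rw [ContinuousLinearMap.flip_mul] at h
  exact h

theorem ae_convDefinedAt {c : ℝ} (hc : 0 < c) (hω : IsWeight ω) (hv : IsWeight v)
    (hmod : ∀ x y, ω (x + y) ≤ c * (ω x * v y)) (hp1 : 1 ≤ p) (hp : p ≠ ∞) {f g : Rd d → ℂ}
    (hf : MemLp f 1 (weightedMeasure 1 v)) (hg : MemLp g p (weightedMeasure p ω)) :
    ∀ᵐ x ∂(volume : Measure (Rd d)), ConvDefinedAt f g x := by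
  have hq0 : 0 < p.toReal := ENNReal.toReal_pos (one_pos.trans_le hp1).ne' hp
  have hf' := hv.aestronglyMeasurable_weightedMeasure_iff.1 hf.1
  have hg' := hω.aestronglyMeasurable_weightedMeasure_iff.1 hg.1
  have h := (lintegral_rpow_weight_mul_le hc hω hv hmod hp1 hp hf' hg').trans_lt
      (ENNReal.mul_lt_top ENNReal.ofReal_lt_top (ENNReal.mul_lt_top hf.2 hg.2))
  rw [ENNReal.rpow_lt_top_iff_of_pos (one_div_pos.2 hq0)] at h
  have hm : AEMeasurable (fun x => (ENNReal.ofReal (ω x) *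
      ∫⁻ y, ‖f y‖ₑ * ‖g (x - y)‖ₑ) ^ p.toReal) volume :=
    (hω.aemeasurable_ofReal.mul
      (aemeasurable_conv_integrand hf'.enorm hg'.enorm).lintegral_prod_right').pow_const _
  filter_upwards [ae_lt_top' hm h.ne] with x hx
  rw [ENNReal.rpow_lt_top_iff_of_pos hq0] at hx
  refine ⟨hf'.convolution_integrand_snd (ContinuousLinearMap.mul ℂ ℂ) hg' x, ?_⟩
  rw [HasFiniteIntegral]
  have : ∀ y, ‖(ContinuousLinearMap.mul ℂ ℂ) (f y) (g (x - y))‖ₑ = ‖f y‖ₑ * ‖g (x - y)‖ₑ := by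
    simp [enorm_mul]
  simp_rw [this]
  by_contra h
  rw [not_lt, top_le_iff] at h
  rw [h, ENNReal.mul_top (ENNReal.ofReal_pos.2 (hω.pos x)).ne'] at hx
  exact lt_irrefl _ hx

end Young

/-! ### Mollifiers -/

/-- `φ` is a continuous mollifier of radius `δ`: it is supported in the ball of radius `δ` about
the origin, and both `φ` and `|φ|` have integral `1`. -/
structure IsMollifier {d : ℕ} (δ : ℝ) (φ : Rd d → ℂ) : Prop where
  continuous : Continuous φ
  support_subset : Function.support φ ⊆ Metric.ball 0 δ
  integral_eq : ∫ x, φ x = 1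
  integral_norm_eq : ∫ x, ‖φ x‖ = 1

section Mollifiers

variable {d : ℕ} {p : ℝ≥0∞} {ω v : Rd d → ℝ}

theorem exists_isMollifier {δ : ℝ} (hδ : 0 < δ) : ∃ φ : Rd d → ℂ, IsMollifier δ φ := by
  let b : ContDiffBump (0 : Rd d) := ⟨δ / 2, δ, by positivity, by linarith⟩
  refine ⟨fun x => (b.normed volume x : ℂ), ?_, ?_, ?_, ?_⟩
  · exact Complex.continuous_ofReal.comp b.continuous_normed
  · intro x hx
    rw [← b.support_normed_eq (μ := volume)]
    simpa using hx
  · rw [integral_complex_ofReal, b.integral_normed, Complex.ofReal_one]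
  · rw [← b.integral_normed (μ := (volume : Measure (Rd d)))]
    congr 1 with x
    rw [Complex.norm_real, Real.norm_of_nonneg (b.nonneg_normed x)]

theorem hasCompactSupport_of_support_subset_closedBall {f : Rd d → ℂ} {r : ℝ}
    (hf : Function.support f ⊆ Metric.closedBall 0 r) : HasCompactSupport f :=
  HasCompactSupport.of_support_subset_isCompact (isCompact_closedBall 0 r) hf

namespace IsMollifier

variable {δ : ℝ} {φ : Rd d → ℂ}

theorem support_subset_closedBall (hφ : IsMollifier δ φ) :
    Function.support φ ⊆ Metric.closedBall 0 δ :=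
  hφ.support_subset.trans Metric.ball_subset_closedBall

theorem hasCompactSupport (hφ : IsMollifier δ φ) : HasCompactSupport φ :=
  hasCompactSupport_of_support_subset_closedBall hφ.support_subset_closedBall

theorem integrable (hφ : IsMollifier δ φ) : Integrable φ volume :=
  hφ.continuous.integrable_of_hasCompactSupport hφ.hasCompactSupport

theorem lintegral_enorm_eq (hφ : IsMollifier δ φ) : ∫⁻ x, ‖φ x‖ₑ = 1 := by
  rw [← ofReal_integral_norm_eq_lintegral_enorm hφ.integrable, hφ.integral_norm_eq,
    ENNReal.ofReal_one]

theorem norm_conv_sub_le (hφ : IsMollifier δ φ) {u : Rd d → ℂ} (hu : Continuous u) {ε : ℝ}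
    (hε : 0 ≤ ε) {x : Rd d} (h : ∀ y ∈ Metric.ball x δ, dist (u y) (u x) ≤ ε) :
    ‖conv φ u x - u x‖ ≤ ε := by
  have := dist_convolution_le' (ContinuousLinearMap.mul ℂ ℂ) (z₀ := u x) hε hφ.integrable
    hφ.support_subset hu.aestronglyMeasurable h
  simp only [ContinuousLinearMap.mul_apply', integral_mul_const, hφ.integral_eq, one_mul,
    hφ.integral_norm_eq, mul_one, ContinuousLinearMap.opNorm_mul] at this
  rwa [dist_eq_norm] at this

end IsMollifier

/-- Mollifications of a continuous compactly supported function converge to it in every `L^p(μ)`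
with `μ` locally finite. -/
theorem exists_forall_eLpNorm_conv_sub_le_of_continuous (μ : Measure (Rd d))
    [IsLocallyFiniteMeasure μ] {u : Rd d → ℂ} (hu : Continuous u)
    (hc : HasCompactSupport u) {ε : ℝ≥0∞} (hε : ε ≠ 0) :
    ∃ δ > 0, ∀ δ' ≤ δ, ∀ φ : Rd d → ℂ, IsMollifier δ' φ →
      eLpNorm (conv φ u - u) p μ ≤ ε := by
  -- mollifiers of radius at most `1` keep the supports inside the compact set `K`
  set K : Set (Rd d) := Metric.cthickening 1 (tsupport u) with hK
  have hKc : IsCompact K := hc.isCompact.cthickening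
  -- the sup norm on `K` controls the `L^p(μ)` norm
  obtain ⟨η, hη, hηε⟩ : ∃ η : ℝ, 0 < η ∧ μ K ^ p.toReal⁻¹ * ENNReal.ofReal η ≤ ε := by
    have hfin : μ K ^ p.toReal⁻¹ ≠ ∞ :=
      (ENNReal.rpow_lt_top_of_nonneg (inv_nonneg.2 ENNReal.toReal_nonneg)
        hKc.measure_lt_top.ne).ne
    obtain ⟨η, hη, h⟩ := ENNReal.exists_nnreal_pos_mul_lt hfin hε
    refine ⟨η, by exact_mod_cast hη, ?_⟩
    rw [ENNReal.ofReal_coe_nnreal, mul_comm]; exact h.le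
  obtain ⟨δ, hδ, hδu⟩ := Metric.uniformContinuous_iff.1
    (hc.uniformContinuous_of_continuous hu) η hη
  refine ⟨min δ 1, by positivity, fun δ' hδ' φ hφ => ?_⟩
  have hb : ∀ x, ‖(conv φ u - u) x‖ ≤ η := fun x =>
    hφ.norm_conv_sub_le hu hη.le fun y hy =>
      (hδu ((Metric.mem_ball.1 hy).trans_le (hδ'.trans (min_le_left _ _)))).le
  have hs : Function.support (conv φ u - u) ⊆ K := by
    refine (Function.support_sub _ _).trans (Set.union_subset ?_ ?_)
    · refine (support_convolution_subset (ContinuousLinearMap.mul ℂ ℂ)).trans ?_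
      rintro _ ⟨y, hy, z, hz, rfl⟩
      refine Metric.mem_cthickening_of_dist_le _ z _ _ (subset_tsupport _ hz) ?_
      have := Metric.mem_ball.1 (hφ.support_subset hy)
      rw [dist_zero_right] at this
      simpa [dist_eq_norm] using (this.le.trans hδ').trans (min_le_right _ _)
    · exact (subset_tsupport _).trans (Metric.self_subset_cthickening _)
  rw [← eLpNorm_restrict_eq_of_support_subset hs]
  refine (eLpNorm_le_of_ae_bound (Filter.Eventually.of_forall hb)).trans ?_
  rwa [Measure.restrict_apply_univ]

theorem lintegral_enorm_mul_weight_le {M : ℝ} {B : Set (Rd d)}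
    (hM : ∀ᵐ x ∂volume, x ∈ B → |v x| ≤ M) {φ : Rd d → ℂ} (hφ : Function.support φ ⊆ B) :
    ∫⁻ x, ‖φ x‖ₑ * ENNReal.ofReal (v x) ≤ (∫⁻ x, ‖φ x‖ₑ) * ENNReal.ofReal M := by
  rw [← lintegral_mul_const' _ _ ENNReal.ofReal_ne_top]
  refine lintegral_mono_ae ?_
  filter_upwards [hM] with x hx
  by_cases h : φ x = 0
  · simp [h]
  · gcongr
    exact (le_abs_self _).trans (hx (hφ h))

/-- Mollifiers of radius at most `1` are bounded in `L^1_{(v)}`. -/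
theorem IsWeight.exists_forall_eLpNorm_mollifier_le (hv : IsWeight v) :
    ∃ M : ℝ, 0 < M ∧ ∀ δ ≤ 1, ∀ φ : Rd d → ℂ, IsMollifier δ φ →
      eLpNorm φ 1 (weightedMeasure 1 v) ≤ ENNReal.ofReal M := by
  obtain ⟨M, hM, h⟩ := hv.locallyLInfty.exists_ae_norm_le (isCompact_closedBall (0 : Rd d) 1)
  refine ⟨M, hM, fun δ hδ φ hφ => ?_⟩
  rw [hv.eLpNorm_one_weightedMeasure]
  refine (lintegral_enorm_mul_weight_le h (hφ.support_subset_closedBall.trans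
    (Metric.closedBall_subset_closedBall hδ))).trans_eq ?_
  rw [hφ.lintegral_enorm_eq, one_mul]

theorem IsWeight.memLp_one_of_continuous (hv : IsWeight v) {f : Rd d → ℂ} (hf : Continuous f)
    (hc : HasCompactSupport f) : MemLp f 1 (weightedMeasure 1 v) := by
  have := hv.isLocallyFiniteMeasure_weightedMeasure (p := 1)
  exact hf.memLp_of_hasCompactSupport hc

theorem conv_sub_right {φ f u : Rd d → ℂ} (hφ : Continuous φ) (hc : HasCompactSupport φ)
    (hf : LocallyIntegrable f volume) (hu : LocallyIntegrable u volume) :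
    conv φ (f - u) = conv φ f - conv φ u := by
  ext x
  have h1 := hc.convolutionExists_left (ContinuousLinearMap.mul ℂ ℂ) hφ hf x
  have h2 := hc.convolutionExists_left (ContinuousLinearMap.mul ℂ ℂ) hφ hu x
  simp only [conv, convolution_def, Pi.sub_apply, map_sub]
  exact integral_sub h1 h2

/-- Mollifications converge in `L^p_{(ω)}`. -/
theorem exists_forall_eLpNorm_conv_sub_le {c : ℝ} (hc : 0 < c) (hω : IsWeight ω)
    (hv : IsWeight v) (hmod : ∀ x y, ω (x + y) ≤ c * (ω x * v y)) (hp1 : 1 ≤ p) (hp : p ≠ ∞)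
    {f : Rd d → ℂ} (hf : MemLp f p (weightedMeasure p ω)) {ε : ℝ≥0∞} (hε : ε ≠ 0) :
    ∃ δ > 0, ∀ δ' ≤ δ, ∀ φ : Rd d → ℂ, IsMollifier δ' φ →
      eLpNorm (conv φ f - f) p (weightedMeasure p ω) ≤ ε := by
  have := hω.isLocallyFiniteMeasure_weightedMeasure (p := p)
  obtain ⟨M, hM, hMφ⟩ := hv.exists_forall_eLpNorm_mollifier_le
  have hε3 : ε / 3 ≠ 0 := (ENNReal.div_pos hε (by norm_num)).ne'
  have hT : ENNReal.ofReal c * ENNReal.ofReal M ≠ ∞ :=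
    ENNReal.mul_ne_top ENNReal.ofReal_ne_top ENNReal.ofReal_ne_top
  obtain ⟨η, hη, hηε⟩ := ENNReal.exists_nnreal_pos_mul_lt hT hε3
  have hη' : min (η : ℝ≥0∞) (ε / 3) ≠ 0 := by
    refine (lt_min (by exact_mod_cast hη) (pos_iff_ne_zero.2 hε3)).ne'
  -- `u` is so close to `f` that `f - u` and its mollifications are all within `ε / 3` of zero
  obtain ⟨u, huc, hfu, hu, hup⟩ := hf.exists_hasCompactSupport_eLpNorm_sub_le hp hη'
  obtain ⟨δ, hδ, h⟩ := exists_forall_eLpNorm_conv_sub_le_of_continuous (weightedMeasure p ω)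
    (p := p) hu huc hε3
  refine ⟨min δ 1, by positivity, fun δ' hδ' φ hφ => ?_⟩
  have hfu1 : eLpNorm (f - u) p (weightedMeasure p ω) ≤ η := hfu.trans (min_le_left _ _)
  have hfu2 : eLpNorm (f - u) p (weightedMeasure p ω) ≤ ε / 3 := hfu.trans (min_le_right _ _)
  have hfl := hω.locallyIntegrable_of_memLp hp1 hp hf
  have hul := hω.locallyIntegrable_of_memLp hp1 hp hup
  have hfum := hω.aestronglyMeasurable_weightedMeasure_iff.1 (hf.sub hup).1
  have e : conv φ f - f = conv φ (f - u) + (conv φ u - u) - (f - u) := by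
    rw [conv_sub_right hφ.continuous hφ.hasCompactSupport hfl hul]; abel
  have h1 : eLpNorm (conv φ (f - u)) p (weightedMeasure p ω) ≤ ε / 3 := by
    refine (eLpNorm_conv_le hc hω hv hmod hp1 hp hφ.continuous.aestronglyMeasurable hfum).trans ?_
    calc ENNReal.ofReal c * (eLpNorm φ 1 (weightedMeasure 1 v) *
          eLpNorm (f - u) p (weightedMeasure p ω))
        ≤ ENNReal.ofReal c * (ENNReal.ofReal M * η) := by
          gcongr
          exact hMφ δ' (hδ'.trans (min_le_right _ _)) φ hφ
      _ = η * (ENNReal.ofReal c * ENNReal.ofReal M) := by ring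
      _ ≤ ε / 3 := hηε.le
  have h2 := h δ' (hδ'.trans (min_le_left _ _)) φ hφ
  have m1 := hω.aestronglyMeasurable_weightedMeasure_iff (p := p) |>.2
    (aestronglyMeasurable_conv hφ.continuous.aestronglyMeasurable hfum)
  have m2 := hω.aestronglyMeasurable_weightedMeasure_iff (p := p) |>.2
    ((aestronglyMeasurable_conv hφ.continuous.aestronglyMeasurable hu.aestronglyMeasurable).sub
      hu.aestronglyMeasurable)
  rw [e]
  calc _ ≤ eLpNorm (conv φ (f - u) + (conv φ u - u)) p (weightedMeasure p ω) +
        eLpNorm (f - u) p (weightedMeasure p ω) := eLpNorm_sub_le (m1.add m2) (hf.sub hup).1 hp1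
    _ ≤ (eLpNorm (conv φ (f - u)) p (weightedMeasure p ω) +
        eLpNorm (conv φ u - u) p (weightedMeasure p ω)) +
        eLpNorm (f - u) p (weightedMeasure p ω) := by
          gcongr; exact eLpNorm_add_le m1 m2 hp1
    _ ≤ ε / 3 + ε / 3 + ε / 3 := by gcongr
    _ = ε := ENNReal.add_thirds ε

end Mollifiers

/-! ### Factorization in weighted Lebesgue spaces -/

section WeightedFactorization

variable {d : ℕ} {p : ℝ≥0∞} {ω v : Rd d → ℝ}

theorem conv_congr {f f' g g' : Rd d → ℂ} (hf : f =ᵐ[volume] f') (hg : g =ᵐ[volume] g') :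
    conv f g = conv f' g' :=
  convolution_congr _ hf hg

theorem conv_assoc {f φ g : Rd d → ℂ} (hf : Continuous f) (hfc : HasCompactSupport f)
    (hφ : Continuous φ) (hφc : HasCompactSupport φ) (hg : LocallyIntegrable g volume) :
    conv (conv f φ) g = conv f (conv φ g) := by
  ext x
  refine convolution_assoc (ContinuousLinearMap.mul ℂ ℂ) (ContinuousLinearMap.mul ℂ ℂ)
    (ContinuousLinearMap.mul ℂ ℂ) (ContinuousLinearMap.mul ℂ ℂ)
    (fun a b c => mul_assoc a b c) hf.aestronglyMeasurable hφ.aestronglyMeasurable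
    hg.aestronglyMeasurable ?_ ?_ ?_
  · exact Filter.Eventually.of_forall
      (hfc.convolutionExists_left _ hf hφ.locallyIntegrable)
  · exact Filter.Eventually.of_forall
      (hφc.norm.convolutionExists_left _ hφ.norm fun y => (hg y).norm)
  · exact hfc.norm.convolutionExists_left _ hf.norm
      (hφc.norm.continuous_convolution_left _ hφ.norm fun y => (hg y).norm).locallyIntegrable x

/-- Convolution as a bounded bilinear map `L^1_{(v)} × L^p_{(ω)} → L^p_{(ω)}`. -/
theorem exists_convolution_bilinear [Fact (1 ≤ p)] (hp : p ≠ ∞) (hω : IsWeight ω)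
    (hv : IsWeight v) (hmod : IsModerate ω v) :
    ∃ B : Lp ℂ 1 (weightedMeasure 1 v) →L[ℂ] Lp ℂ p (weightedMeasure p ω) →L[ℂ]
        Lp ℂ p (weightedMeasure p ω), ∀ F G, B F G =ᵐ[volume] conv F G := by
  obtain ⟨c, hc, hmod⟩ := hmod
  have hp1 : 1 ≤ p := Fact.out
  have hm : ∀ (F : Lp ℂ 1 (weightedMeasure 1 v)) (G : Lp ℂ p (weightedMeasure p ω)),
      MemLp (conv F G) p (weightedMeasure p ω) := fun F G =>
    memLp_conv hc hω hv hmod hp1 hp (Lp.memLp F) (Lp.memLp G)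
  have hex : ∀ (F : Lp ℂ 1 (weightedMeasure 1 v)) (G : Lp ℂ p (weightedMeasure p ω)),
      ∀ᵐ x ∂(volume : Measure (Rd d)), ConvDefinedAt F G x := fun F G =>
    ae_convDefinedAt hc hω hv hmod hp1 hp (Lp.memLp F) (Lp.memLp G)
  have hvae := hv.ae_weightedMeasure (p := 1)
  have hωae := hω.ae_weightedMeasure (p := p)
  refine ⟨(LinearMap.mk₂ ℂ (fun F G => (hm F G).toLp _) ?_ ?_ ?_ ?_).mkContinuous₂ c ?_, ?_⟩
  · intro F F' G
    rw [← MemLp.toLp_add, MemLp.toLp_eq_toLp_iff, Filter.EventuallyEq, hωae]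
    have e : ⇑(F + F') =ᵐ[volume] ⇑F + ⇑F' := by
      rw [Filter.EventuallyEq, ← hvae]; exact Lp.coeFn_add F F'
    rw [conv_congr e Filter.EventuallyEq.rfl]
    filter_upwards [hex F G, hex F' G] with x h1 h2
    exact h1.add_distrib h2
  · intro a F G
    rw [← MemLp.toLp_const_smul, MemLp.toLp_eq_toLp_iff, Filter.EventuallyEq, hωae]
    have e : ⇑(a • F) =ᵐ[volume] a • ⇑F := by
      rw [Filter.EventuallyEq, ← hvae]; exact Lp.coeFn_smul a F
    rw [conv_congr e Filter.EventuallyEq.rfl]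
    exact Filter.Eventually.of_forall fun x => congrFun smul_convolution x
  · intro F G G'
    rw [← MemLp.toLp_add, MemLp.toLp_eq_toLp_iff, Filter.EventuallyEq, hωae]
    have e : ⇑(G + G') =ᵐ[volume] ⇑G + ⇑G' := by
      rw [Filter.EventuallyEq, ← hωae]; exact Lp.coeFn_add G G'
    rw [conv_congr Filter.EventuallyEq.rfl e]
    filter_upwards [hex F G, hex F G'] with x h1 h2
    exact h1.distrib_add h2
  · intro a F G
    rw [← MemLp.toLp_const_smul, MemLp.toLp_eq_toLp_iff, Filter.EventuallyEq, hωae]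
    have e : ⇑(a • G) =ᵐ[volume] a • ⇑G := by
      rw [Filter.EventuallyEq, ← hωae]; exact Lp.coeFn_smul a G
    rw [conv_congr Filter.EventuallyEq.rfl e]
    exact Filter.Eventually.of_forall fun x => congrFun convolution_smul x
  · intro F G
    rw [LinearMap.mk₂_apply, Lp.norm_toLp, Lp.norm_def, Lp.norm_def]
    have h := eLpNorm_conv_le hc hω hv hmod hp1 hp
      (hv.aestronglyMeasurable_weightedMeasure_iff.1 (Lp.memLp F).1)
      (hω.aestronglyMeasurable_weightedMeasure_iff.1 (Lp.memLp G).1)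
    have h' := ENNReal.toReal_mono (ENNReal.mul_ne_top ENNReal.ofReal_ne_top
      (ENNReal.mul_ne_top (Lp.memLp F).2.ne (Lp.memLp G).2.ne)) h
    rwa [ENNReal.toReal_mul, ENNReal.toReal_mul, ENNReal.toReal_ofReal hc.le, ← mul_assoc] at h'
  · intro F G
    rw [LinearMap.mkContinuous₂_apply, LinearMap.mk₂_apply, Filter.EventuallyEq, ← hωae]
    exact MemLp.coeFn_toLp _

/-- The classes of continuous functions supported in the closed ball of radius `r` about the
origin, as a subspace of `L^1_{(v)}`. -/
def continuousSupportedIn (v : Rd d → ℝ) (r : ℝ) :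
    Submodule ℂ (Lp ℂ 1 (weightedMeasure 1 v)) where
  carrier := {F | ∃ f : Rd d → ℂ, Continuous f ∧ Function.support f ⊆ Metric.closedBall 0 r ∧
    F =ᵐ[weightedMeasure 1 v] f}
  zero_mem' := ⟨0, continuous_zero, by simp, Lp.coeFn_zero _ _ _⟩
  add_mem' := by
    rintro F F' ⟨f, hf, hs, he⟩ ⟨f', hf', hs', he'⟩
    exact ⟨f + f', hf.add hf', (Function.support_add _ _).trans (Set.union_subset hs hs'),
      (Lp.coeFn_add F F').trans (he.add he')⟩
  smul_mem' := by
    rintro a F ⟨f, hf, hs, he⟩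
    exact ⟨a • f, hf.const_smul a, (Function.support_const_smul_subset a f).trans hs,
      (Lp.coeFn_smul a F).trans (he.const_smul a)⟩

theorem continuousSupportedIn_mono {r r' : ℝ} (h : r ≤ r') :
    continuousSupportedIn v r ≤ continuousSupportedIn v r' := by
  rintro F ⟨f, hf, hs, he⟩
  exact ⟨f, hf, hs.trans (Metric.closedBall_subset_closedBall h), he⟩

/-- Vanishing outside a closed ball survives limits in `L^1_{(v)}`. -/
theorem ae_eq_zero_of_mem_closure {r : ℝ} {F : Lp ℂ 1 (weightedMeasure 1 v)}
    (hF : F ∈ closure (continuousSupportedIn v r : Set (Lp ℂ 1 (weightedMeasure 1 v)))) :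
    ∀ᵐ x ∂weightedMeasure 1 v, x ∉ Metric.closedBall (0 : Rd d) r → F x = 0 := by
  have hB : MeasurableSet (Metric.closedBall (0 : Rd d) r)ᶜ := measurableSet_closedBall.compl
  have h0 : eLpNorm F 1 ((weightedMeasure 1 v).restrict (Metric.closedBall 0 r)ᶜ) = 0 := by
    refine le_antisymm (le_of_forall_pos_le_add fun ε hε => ?_) zero_le
    obtain ⟨F', ⟨f, -, hs, he⟩, hd⟩ := EMetric.mem_closure_iff.1 hF ε hε
    rw [zero_add]
    refine le_trans ?_ hd.le
    rw [Lp.edist_def]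
    refine le_trans (le_of_eq ?_) (eLpNorm_restrict_le _ _ _ (Metric.closedBall 0 r)ᶜ)
    refine eLpNorm_congr_ae ?_
    filter_upwards [ae_restrict_of_ae he, ae_restrict_mem hB] with x hx hxB
    have : f x = 0 := by
      by_contra h
      exact hxB (hs h)
    simp [hx, this]
  rw [eLpNorm_eq_zero_iff (Lp.memLp F).1.restrict one_ne_zero, Filter.EventuallyEq,
    ae_restrict_iff' hB] at h0
  exact h0

/-- Every `h ∈ L^p_{(ω)}` is the convolution of an `L^1_{(v)}` function supported in the closed
unit ball and an element of `L^p_{(ω)}`. -/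
theorem exists_eq_conv (hp1 : 1 ≤ p) (hp : p ≠ ∞) (hω : IsWeight ω)
    (hv : IsWeight v) (hmod : IsModerate ω v) {h : Rd d → ℂ}
    (hh : MemLp h p (weightedMeasure p ω)) :
    ∃ f g : Rd d → ℂ, MemLp f 1 (weightedMeasure 1 v) ∧
      (∀ᵐ x ∂volume, x ∉ Metric.closedBall (0 : Rd d) 1 → f x = 0) ∧
      MemLp g p (weightedMeasure p ω) ∧ h =ᵐ[volume] conv f g := by
  have : Fact (1 ≤ p) := ⟨hp1⟩
  have hvae := hv.ae_weightedMeasure (p := 1)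
  have hωae := hω.ae_weightedMeasure (p := p)
  have := hv.isLocallyFiniteMeasure_weightedMeasure (p := 1)
  obtain ⟨B, hB⟩ := exists_convolution_bilinear hp hω hv hmod
  obtain ⟨c, hc, hmod⟩ := hmod
  obtain ⟨M, hM, hMφ⟩ := hv.exists_forall_eLpNorm_mollifier_le
  -- the radii `1 - 2⁻ⁿ` leave room for one more mollification at every stage
  have hpow : ∀ n : ℕ, (1 / 2 : ℝ) ^ (n + 1) = (1 / 2) ^ n / 2 := fun n => by ring
  have hle : ∀ n : ℕ, (1 / 2 : ℝ) ^ n ≤ 1 := fun n => pow_le_one₀ (by norm_num) (by norm_num)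
  have hpos : ∀ n : ℕ, 0 < (1 / 2 : ℝ) ^ n := fun n => by positivity
  obtain ⟨F, hF, G, hFG⟩ : ∃ F ∈ closure (⋃ n : ℕ, (continuousSupportedIn v (1 - (1 / 2) ^ n) :
      Set (Lp ℂ 1 (weightedMeasure 1 v)))), ∃ G, B F G = hh.toLp h := by
    refine exists_bilinear_apply_eq B (fun n => continuousSupportedIn v (1 - (1 / 2) ^ n))
      (fun n => continuousSupportedIn_mono (by linarith [hpow n, hpos n]))
      (max M (‖B‖ * M)) ?_ _
    rintro n F ⟨f, hf, hs, he⟩ G ε hε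
    have hfc := hasCompactSupport_of_support_subset_closedBall hs
    have hε' : ENNReal.ofReal ε ≠ 0 := (ENNReal.ofReal_pos.2 hε).ne'
    obtain ⟨δ₁, hδ₁, H₁⟩ := exists_forall_eLpNorm_conv_sub_le_of_continuous (weightedMeasure 1 v)
      (p := 1) hf hfc hε'
    obtain ⟨δ₂, hδ₂, H₂⟩ := exists_forall_eLpNorm_conv_sub_le hc hω hv hmod hp1 hp
      (Lp.memLp G) hε'
    obtain ⟨φ, hφ⟩ := exists_isMollifier (d := d)
      (lt_min (lt_min hδ₁ hδ₂) (hpos (n + 1)))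
    have hr : min (min δ₁ δ₂) ((1 / 2) ^ (n + 1)) ≤ (1 / 2 : ℝ) ^ (n + 1) := min_le_right _ _
    have hφ1 : eLpNorm φ 1 (weightedMeasure 1 v) ≤ ENNReal.ofReal M :=
      hMφ _ (hr.trans (hle _)) φ hφ
    have hφs := hφ.support_subset_closedBall.trans (Metric.closedBall_subset_closedBall hr)
    have hφm := hv.memLp_one_of_continuous hφ.continuous hφ.hasCompactSupport
    have hfφ : Continuous (conv f φ) :=
      hfc.continuous_convolution_left _ hf hφ.continuous.locallyIntegrable
    have hfφs : Function.support (conv f φ) ⊆ Metric.closedBall 0 (1 - (1 / 2) ^ (n + 1)) := by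
      refine (support_convolution_subset _).trans ((Set.add_subset_add hs hφs).trans ?_)
      rintro _ ⟨y, hy, z, hz, rfl⟩
      rw [mem_closedBall_zero_iff] at hy hz ⊢
      linarith [norm_add_le y z, hpow n]
    have hfφm := hv.memLp_one_of_continuous hfφ
      (hasCompactSupport_of_support_subset_closedBall hfφs)
    have hΦ : ‖hφm.toLp φ‖ ≤ M := by
      rw [Lp.norm_toLp]; exact ENNReal.toReal_le_of_le_ofReal hM.le hφ1
    have eφ : hφm.toLp φ =ᵐ[volume] φ := by
      rw [Filter.EventuallyEq, ← hvae]; exact hφm.coeFn_toLp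
    have efφ : hfφm.toLp (conv f φ) =ᵐ[volume] conv f φ := by
      rw [Filter.EventuallyEq, ← hvae]; exact hfφm.coeFn_toLp
    have ef : F =ᵐ[volume] f := by
      rw [Filter.EventuallyEq, ← hvae]; exact he
    have hBφ : ∀ G', B (hφm.toLp φ) G' =ᵐ[volume] conv φ G' := fun G' =>
      (hB _ _).trans (conv_congr eφ Filter.EventuallyEq.rfl).eventuallyEq
    -- the witnesses are the classes of `φ` and of `conv f φ`
    refine ⟨hφm.toLp φ, ⟨φ, hφ.continuous, hφs.trans (Metric.closedBall_subset_closedBall ?_),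
      hφm.coeFn_toLp⟩, hfφm.toLp _, ⟨conv f φ, hfφ, hfφs, hfφm.coeFn_toLp⟩,
      hΦ.trans (le_max_left _ _), ?_, ?_, ?_, ?_⟩
    · linarith [hpow n, hle n]
    · refine le_trans ?_ (le_max_right _ _)
      exact (B.le_opNorm _).trans (by gcongr)
    · rw [Lp.norm_def]
      refine ENNReal.toReal_le_of_le_ofReal hε.le (le_trans (le_of_eq ?_)
        (H₁ _ ((min_le_left _ _).trans (min_le_left _ _)) φ hφ))
      rw [conv_comm φ f]
      exact eLpNorm_congr_ae ((Lp.coeFn_sub _ _).trans (hfφm.coeFn_toLp.sub he))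
    · rw [Lp.norm_def]
      refine ENNReal.toReal_le_of_le_ofReal hε.le (le_trans (le_of_eq ?_)
        (H₂ _ ((min_le_left _ _).trans (min_le_right _ _)) φ hφ))
      have this : B (hφm.toLp φ) G =ᵐ[weightedMeasure p ω] conv φ G := by
        rw [Filter.EventuallyEq, hωae]; exact hBφ G
      exact eLpNorm_congr_ae ((Lp.coeFn_sub _ _).trans (this.sub Filter.EventuallyEq.rfl))
    · intro G'
      refine Lp.ext ?_
      rw [Filter.EventuallyEq, hωae]
      have hG' := hω.locallyIntegrable_of_memLp hp1 hp (Lp.memLp G')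
      refine (hB _ _).trans ?_
      rw [conv_congr efφ Filter.EventuallyEq.rfl, conv_assoc hf hfc hφ.continuous
        hφ.hasCompactSupport hG', ← conv_congr ef (hBφ G')]
      exact (hB _ _).symm
  refine ⟨F, G, Lp.memLp F, ?_, Lp.memLp G, ?_⟩
  · rw [← hvae]
    refine ae_eq_zero_of_mem_closure (closure_mono (Set.iUnion_subset fun n => ?_) hF)
    exact continuousSupportedIn_mono (by linarith [hpos n])
  · have h1 : hh.toLp h =ᵐ[volume] h := by
      rw [Filter.EventuallyEq, ← hωae]; exact hh.coeFn_toLp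
    rw [← hFG] at h1
    exact h1.symm.trans (hB F G)

end WeightedFactorization

/-! ### Wiener amalgam spaces -/

section Wiener

variable {d : ℕ} {v : Rd d → ℝ}

/-- The coordinatewise floor. Its fibres are the half-open unit cubes, which partition the space;
the closed cubes `latticeCube k` agree with them up to null sets. -/
noncomputable def floorMap (x : Rd d) : Fin d → ℤ := fun i => ⌊x i⌋

theorem measurable_floorMap : Measurable (floorMap (d := d)) := by
  refine measurable_pi_lambda _ fun i => Int.measurable_floor.comp ?_
  fun_prop

theorem latticeCube_eq_image (k : Fin d → ℤ) : latticeCube k =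
    WithLp.toLp 2 '' Set.Icc (fun i => (k i : ℝ)) (fun i => (k i : ℝ) + 1) := by
  ext x
  constructor
  · intro hx
    exact ⟨WithLp.ofLp x, ⟨fun i => (hx i).1, fun i => (hx i).2⟩, rfl⟩
  · rintro ⟨y, hy, rfl⟩ i
    exact ⟨hy.1 i, hy.2 i⟩

theorem latticeCube_eq_preimage (k : Fin d → ℤ) : latticeCube k =
    WithLp.ofLp ⁻¹' Set.Icc (fun i => (k i : ℝ)) (fun i => (k i : ℝ) + 1) := by
  ext x
  exact ⟨fun hx => ⟨fun i => (hx i).1, fun i => (hx i).2⟩, fun hx i => ⟨hx.1 i, hx.2 i⟩⟩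

theorem isCompact_latticeCube (k : Fin d → ℤ) : IsCompact (latticeCube k) := by
  rw [latticeCube_eq_image]
  exact isCompact_Icc.image (PiLp.continuous_toLp 2 _)

theorem volume_latticeCube (k : Fin d → ℤ) : volume (latticeCube k) = 1 := by
  rw [latticeCube_eq_preimage, (PiLp.volume_preserving_ofLp (Fin d)).measure_preimage
    measurableSet_Icc.nullMeasurableSet, Real.volume_Icc_pi]
  simp

theorem latticeCube_ae_eq (k : Fin d → ℤ) :
    (latticeCube k : Set (Rd d)) =ᵐ[volume] floorMap ⁻¹' {k} := by
  have h : (floorMap ⁻¹' {k} : Set (Rd d)) = WithLp.ofLp ⁻¹'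
      (Set.univ.pi fun i => Set.Ico (k i : ℝ) ((k i : ℝ) + 1)) := by
    ext x
    simp [floorMap, funext_iff, Int.floor_eq_iff]
  rw [h, latticeCube_eq_preimage]
  exact ((PiLp.volume_preserving_ofLp (Fin d)).quasiMeasurePreserving.preimage_ae_eq
    Measure.univ_pi_Ico_ae_eq_Icc).symm

/-- The unit cubes tile the space. -/
theorem tsum_lintegral_latticeCube (F : Rd d → ℝ≥0∞) :
    ∑' k : Fin d → ℤ, ∫⁻ x in latticeCube k, F x = ∫⁻ x, F x := by
  have h : (⋃ k : Fin d → ℤ, (floorMap ⁻¹' {k} : Set (Rd d))) = Set.univ := by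
    ext x; simp
  rw [← setLIntegral_univ F, ← h, lintegral_iUnion
    (fun k => measurable_floorMap (measurableSet_singleton k)) (pairwise_disjoint_fiber _)]
  exact tsum_congr fun k => setLIntegral_congr (latticeCube_ae_eq k)

/-- A moderate weight is comparable on every unit cube, up to null sets, to its value at the
lattice point of the cube, with a constant independent of the cube. -/
theorem exists_ae_weight_le (hv : v ∈ ModerateWeights d) :
    ∃ C : ℝ, 0 < C ∧ ∀ k : Fin d → ℤ, ∀ᵐ x ∂(volume : Measure (Rd d)), x ∈ latticeCube k →
      v (latticePoint k) ≤ C * v x ∧ v x ≤ C * v (latticePoint k) := by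
  obtain ⟨hvw, w, hw, c, hc, hmod⟩ := hv
  have hK := isCompact_latticeCube (0 : Fin d → ℤ)
  obtain ⟨M, hM, h1⟩ := hw.locallyLInfty.exists_ae_norm_le hK
  obtain ⟨N, hN, h2⟩ := hw.locallyLInfty.exists_ae_norm_le hK.neg
  refine ⟨c * max M N, by positivity, fun k => ?_⟩
  have h1' := (measurePreserving_sub_right (volume : Measure (Rd d))
    (latticePoint k)).quasiMeasurePreserving.ae h1
  have h2' := (quasiMeasurePreserving_sub_left_of_right_invariant (volume : Measure (Rd d))
    (latticePoint k)).ae h2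
  filter_upwards [h1', h2'] with x hx1 hx2 hx
  have hmem : x - latticePoint k ∈ latticeCube (0 : Fin d → ℤ) := by
    intro i
    have := hx i
    simp only [latticePoint, PiLp.sub_apply, Set.mem_Icc, Pi.zero_apply, Int.cast_zero] at this ⊢
    constructor <;> linarith [this.1, this.2]
  have hM' := (le_abs_self _).trans ((hx1 hmem).trans (le_max_left M N))
  have hN' := (le_abs_self _).trans ((hx2 (by simpa using hmem)).trans (le_max_right M N))
  -- moderateness is used in both directions, with increments in the unit cube and its negative
  have e1 := hmod x (latticePoint k - x)
  have e2 := hmod (latticePoint k) (x - latticePoint k)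
  rw [add_sub_cancel] at e1 e2
  constructor
  · calc v (latticePoint k) ≤ c * (v x * w (latticePoint k - x)) := e1
      _ ≤ c * (v x * max M N) := by have := hvw.pos x; gcongr
      _ = c * max M N * v x := by ring
  · calc v x ≤ c * (v (latticePoint k) * w (x - latticePoint k)) := e2
      _ ≤ c * (v (latticePoint k) * max M N) := by
        have := hvw.pos (latticePoint k); gcongr
      _ = c * max M N * v (latticePoint k) := by ring

theorem wienerNorm_one_lt_top_iff {r : ℝ≥0∞} (hr0 : r ≠ 0) (hr : r ≠ ∞) {f : Rd d → ℂ} :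
    wienerNorm 1 r v f < ∞ ↔ ∑' k : Fin d → ℤ, ((∫⁻ x in latticeCube k, ‖f x‖ₑ) *
      ENNReal.ofReal (v (latticePoint k))) ^ r.toReal < ∞ := by
  rw [wienerNorm, eLpNorm_lt_top_iff_lintegral_rpow_enorm_lt_top hr0 hr, lintegral_count]
  simp [eLpNorm_one_eq_lintegral_enorm]

theorem wienerSpace_one_one (hv : v ∈ ModerateWeights d) :
    WienerSpace 1 1 v = WeightedLp 1 v := by
  obtain ⟨C, hC, h⟩ := exists_ae_weight_le hv
  have hCt : ENNReal.ofReal C ≠ ∞ := ENNReal.ofReal_ne_top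
  have hle : ∀ f : Rd d → ℂ, ∑' k : Fin d → ℤ, (∫⁻ x in latticeCube k, ‖f x‖ₑ) *
      ENNReal.ofReal (v (latticePoint k)) ≤
      ENNReal.ofReal C * ∫⁻ x, ‖f x‖ₑ * ENNReal.ofReal (v x) := by
    intro f
    rw [← tsum_lintegral_latticeCube, ← ENNReal.tsum_mul_left]
    refine ENNReal.tsum_le_tsum fun k => ?_
    rw [← lintegral_mul_const' _ _ ENNReal.ofReal_ne_top, ← lintegral_const_mul' _ _ hCt]
    refine setLIntegral_mono_ae' (isCompact_latticeCube k).measurableSet ?_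
    filter_upwards [h k] with x hx hxk
    rw [mul_left_comm, ← ENNReal.ofReal_mul hC.le]
    gcongr
    exact (hx hxk).1
  have hge : ∀ f : Rd d → ℂ, ∫⁻ x, ‖f x‖ₑ * ENNReal.ofReal (v x) ≤
      ENNReal.ofReal C * ∑' k : Fin d → ℤ, (∫⁻ x in latticeCube k, ‖f x‖ₑ) *
      ENNReal.ofReal (v (latticePoint k)) := by
    intro f
    rw [← tsum_lintegral_latticeCube, ← ENNReal.tsum_mul_left]
    refine ENNReal.tsum_le_tsum fun k => ?_
    rw [← lintegral_mul_const' _ _ ENNReal.ofReal_ne_top, ← lintegral_const_mul' _ _ hCt]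
    refine setLIntegral_mono_ae' (isCompact_latticeCube k).measurableSet ?_
    filter_upwards [h k] with x hx hxk
    rw [mul_left_comm, ← ENNReal.ofReal_mul hC.le]
    gcongr
    exact (hx hxk).2
  ext f
  rw [WienerSpace, Set.mem_ofPred_eq, wienerNorm_one_lt_top_iff one_ne_zero ENNReal.one_ne_top,
    hv.1.mem_weightedLp_iff one_ne_zero ENNReal.one_ne_top, MemLp,
    hv.1.aestronglyMeasurable_weightedMeasure_iff, hv.1.eLpNorm_one_weightedMeasure]
  simp only [ENNReal.toReal_one, ENNReal.rpow_one]
  exact and_congr_right fun _ =>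
    ⟨fun hf => (hge f).trans_lt (ENNReal.mul_lt_top ENNReal.ofReal_lt_top hf),
      fun hf => (hle f).trans_lt (ENNReal.mul_lt_top ENNReal.ofReal_lt_top hf)⟩

/-- The inclusion `ℓ^q ⊆ ℓ^1` for `q ≤ 1`, as an inequality. -/
theorem tsum_rpow_le_tsum_rpow {ι : Type*} (a : ι → ℝ≥0∞) {q : ℝ} (hq0 : 0 < q) (hq1 : q ≤ 1) :
    (∑' i, a i) ^ q ≤ ∑' i, a i ^ q := by
  rw [← ENNReal.le_rpow_inv_iff hq0, ENNReal.tsum_eq_iSup_sum]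
  refine iSup_le fun s => ?_
  rw [ENNReal.le_rpow_inv_iff hq0]
  refine le_trans ?_ (ENNReal.sum_le_tsum s)
  classical
  induction s using Finset.induction_on with
  | empty => simp [hq0]
  | insert i s hi ih =>
    rw [Finset.sum_insert hi, Finset.sum_insert hi]
    exact (ENNReal.rpow_add_le_add_rpow _ _ hq0.le hq1).trans (by gcongr)

theorem wienerSpace_subset {r : ℝ≥0∞} (hr0 : 0 < r) (hr1 : r ≤ 1) :
    WienerSpace 1 r v ⊆ WienerSpace 1 1 v := by
  have hr : r ≠ ∞ := (hr1.trans_lt ENNReal.one_lt_top).ne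
  have hq0 : 0 < r.toReal := ENNReal.toReal_pos hr0.ne' hr
  have hq1 : r.toReal ≤ 1 := by
    rw [← ENNReal.toReal_one]; exact ENNReal.toReal_mono ENNReal.one_ne_top hr1
  rintro f ⟨hf, h⟩
  refine ⟨hf, ?_⟩
  rw [wienerNorm_one_lt_top_iff hr0.ne' hr] at h
  rw [wienerNorm_one_lt_top_iff one_ne_zero ENNReal.one_ne_top]
  simp only [ENNReal.toReal_one, ENNReal.rpow_one]
  have := (tsum_rpow_le_tsum_rpow _ hq0 hq1).trans_lt h
  rwa [ENNReal.rpow_lt_top_iff_of_pos hq0] at this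

/-- An `L^1_{(v)}` function with bounded support belongs to `WL^{1,r}_{(v)}` for every `r`, since
only finitely many cubes meet the support. -/
theorem mem_wienerSpace_of_ae_eq_zero {r : ℝ≥0∞} (hr0 : r ≠ 0) (hr : r ≠ ∞) (hv : IsWeight v)
    {f : Rd d → ℂ} (hf : MemLp f 1 (weightedMeasure 1 v))
    (h0 : ∀ᵐ x ∂volume, x ∉ Metric.closedBall (0 : Rd d) 1 → f x = 0) :
    f ∈ WienerSpace 1 r v := by
  refine ⟨hv.aestronglyMeasurable_weightedMeasure_iff.1 hf.1, ?_⟩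
  have hq0 : 0 < r.toReal := ENNReal.toReal_pos hr0 hr
  have hl := hv.locallyIntegrable_of_memLp le_rfl ENNReal.one_ne_top hf
  -- a cube with corner `k` which meets the unit ball has `-2 ≤ k i ≤ 1` for all `i`
  rw [wienerNorm_one_lt_top_iff hr0 hr,
    tsum_eq_sum (s := Finset.Icc (fun _ : Fin d => (-2 : ℤ)) fun _ => 1)]
  · refine ENNReal.sum_lt_top.2 fun k _ => ?_
    refine ENNReal.rpow_lt_top_of_nonneg hq0.le (ENNReal.mul_ne_top ?_ ENNReal.ofReal_ne_top)
    exact (hl.integrableOn_isCompact (isCompact_latticeCube k)).2.ne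
  · intro k hk
    suffices h : ∫⁻ x in latticeCube k, ‖f x‖ₑ = 0 by simp [h, hq0]
    refine (setLIntegral_congr_fun_ae (g := fun _ => 0)
      (isCompact_latticeCube k).measurableSet ?_).trans (by simp)
    filter_upwards [h0] with x hx hxk
    rw [hx, enorm_zero]
    intro hxb
    refine hk (Finset.mem_Icc.2 ⟨fun i => ?_, fun i => ?_⟩)
    all_goals
      have h1 := (PiLp.norm_apply_le x i).trans (mem_closedBall_zero_iff.1 hxb)
      rw [Real.norm_eq_abs, abs_le] at h1
      have h2 := hxk i
      have h3 : (-2 : ℝ) ≤ k i := by linarith [h2.2]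
      have h4 : (k i : ℝ) ≤ 1 := by linarith [h2.1]
    · exact_mod_cast h3
    · exact_mod_cast h4

/-- The function which on the cube of `k` has the constant value `b k / v k`. -/
noncomputable def stepFunction (v : Rd d → ℝ) (b : (Fin d → ℤ) → ℝ) (x : Rd d) : ℂ :=
  ((b (floorMap x) / v (latticePoint (floorMap x)) : ℝ) : ℂ)

theorem measurable_stepFunction (b : (Fin d → ℤ) → ℝ) : Measurable (stepFunction v b) :=
  (Measurable.of_discrete (f := fun k : Fin d → ℤ => ((b k / v (latticePoint k) : ℝ) : ℂ))).comp
    measurable_floorMap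

theorem lintegral_stepFunction (hv : IsWeight v) {b : (Fin d → ℤ) → ℝ} (hb : ∀ k, 0 ≤ b k)
    (k : Fin d → ℤ) :
    (∫⁻ x in latticeCube k, ‖stepFunction v b x‖ₑ) * ENNReal.ofReal (v (latticePoint k)) =
      ENNReal.ofReal (b k) := by
  have hvk := hv.pos (latticePoint k)
  have h : ∀ x ∈ (floorMap ⁻¹' {k} : Set (Rd d)),
      ‖stepFunction v b x‖ₑ = ENNReal.ofReal (b k / v (latticePoint k)) := by
    intro x hx
    have hx' : floorMap x = k := hx
    rw [stepFunction, hx', ← ofReal_norm, Complex.norm_real,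
      Real.norm_of_nonneg (div_nonneg (hb k) hvk.le)]
  rw [setLIntegral_congr (latticeCube_ae_eq k), setLIntegral_congr_fun
    (measurable_floorMap (measurableSet_singleton k)) h, setLIntegral_const,
    ← measure_congr (latticeCube_ae_eq k), volume_latticeCube, mul_one,
    ← ENNReal.ofReal_mul (div_nonneg (hb k) hvk.le), div_mul_cancel₀ _ hvk.ne']

theorem stepFunction_mem_wienerSpace_iff {r : ℝ≥0∞} (hr0 : r ≠ 0) (hr : r ≠ ∞) (hv : IsWeight v)
    {b : (Fin d → ℤ) → ℝ} (hb : ∀ k, 0 ≤ b k) :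
    stepFunction v b ∈ WienerSpace 1 r v ↔ ∑' k, ENNReal.ofReal (b k) ^ r.toReal < ∞ := by
  rw [WienerSpace, Set.mem_ofPred_eq, wienerNorm_one_lt_top_iff hr0 hr]
  simp only [lintegral_stepFunction hv hb]
  exact and_iff_right (measurable_stepFunction b).aestronglyMeasurable

/-- The inclusion `ℓ^q ⊆ ℓ^1` is strict for `q < 1` over an infinite index set. -/
theorem exists_tsum_lt_top_tsum_rpow_eq_top {ι : Type*} [Infinite ι] {q : ℝ} (hq0 : 0 < q)
    (hq1 : q < 1) : ∃ b : ι → ℝ, (∀ k, 0 ≤ b k) ∧ ∑' k, ENNReal.ofReal (b k) < ∞ ∧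
      ∑' k, ENNReal.ofReal (b k) ^ q = ∞ := by
  let e := Infinite.natEmbedding ι
  -- `s n = (n + 1) ^ (-1 / q)` is summable, but its `q`-th power is the harmonic series
  let s : ℕ → ℝ := fun n => (n + 1 : ℝ) ^ (-q⁻¹)
  have hs : ∀ n, 0 ≤ s n := fun n => by positivity
  have hsupp : ∀ k ∉ Set.range e, Function.extend e s 0 k = 0 := fun k hk =>
    Function.extend_apply' _ _ _ hk
  refine ⟨Function.extend e s 0, fun k => ?_, ?_, ?_⟩
  · by_cases hk : k ∈ Set.range e
    · obtain ⟨n, rfl⟩ := hk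
      rw [e.injective.extend_apply]; exact hs n
    · rw [hsupp k hk]
  · rw [← e.injective.tsum_eq (f := fun k => ENNReal.ofReal (Function.extend e s 0 k))
      (Function.support_subset_iff'.2 fun k hk => by simp [hsupp k hk])]
    simp only [e.injective.extend_apply]
    refine Summable.tsum_ofReal_lt_top ?_
    have h := (summable_nat_add_iff 1).2 (Real.summable_nat_rpow.2
      (neg_lt_neg ((one_lt_inv₀ hq0).2 hq1)))
    simpa [s] using h
  · rw [← e.injective.tsum_eq (f := fun k => ENNReal.ofReal (Function.extend e s 0 k) ^ q)
      (Function.support_subset_iff'.2 fun k hk => by simp [hsupp k hk, hq0])]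
    simp only [e.injective.extend_apply]
    by_contra h
    have h1 := ENNReal.summable_toReal h
    refine Real.not_summable_one_div_natCast ((summable_nat_add_iff 1).1 (h1.congr fun n => ?_))
    rw [← ENNReal.toReal_rpow, ENNReal.toReal_ofReal (hs n), ← Real.rpow_mul (by positivity),
      neg_mul, inv_mul_cancel₀ hq0.ne', Real.rpow_neg_one, one_div]
    push_cast; rfl

theorem wienerSpace_ssubset {r : ℝ≥0∞} (hd : 0 < d) (hr0 : 0 < r) (hr1 : r < 1)
    (hv : v ∈ ModerateWeights d) : WienerSpace 1 r v ⊂ WeightedLp 1 v := by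
  have hr : r ≠ ∞ := (hr1.trans ENNReal.one_lt_top).ne
  have hq0 : 0 < r.toReal := ENNReal.toReal_pos hr0.ne' hr
  have hq1 : r.toReal < 1 := by
    rw [← ENNReal.toReal_one]; exact ENNReal.toReal_strict_mono ENNReal.one_ne_top hr1
  rw [← wienerSpace_one_one hv]
  refine ⟨wienerSpace_subset hr0 hr1.le, fun h => ?_⟩
  have : Nonempty (Fin d) := ⟨⟨0, hd⟩⟩
  obtain ⟨b, hb, hb1, hbr⟩ := exists_tsum_lt_top_tsum_rpow_eq_top (ι := Fin d → ℤ) hq0 hq1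
  have h1 : stepFunction v b ∈ WienerSpace 1 1 v := by
    rw [stepFunction_mem_wienerSpace_iff one_ne_zero ENNReal.one_ne_top hv.1 hb]
    simpa using hb1
  have h2 := (stepFunction_mem_wienerSpace_iff hr0.ne' hr hv.1 hb).1 (h h1)
  exact h2.ne hbr

end Wiener

/-! ### The convolution identities -/

theorem mainTheorem3 (d : ℕ) (r p : ℝ≥0∞) (hr0 : 0 < r) (hr1 : r ≤ 1) (hp1 : 1 ≤ p) (hp : p < ∞)
    (ω v : Rd d → ℝ) (hω : ω ∈ ModerateWeights d) (hv : v ∈ ModerateWeights d)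
    (hωv : IsModerate ω v) :
    (∀ f ∈ WienerSpace 1 r v, ∀ g ∈ WeightedLp p ω,
      ∀ᵐ x ∂(volume : Measure (Rd d)), ConvDefinedAt f g x ∧ ConvDefinedAt g f x) ∧
    convSet (WienerSpace 1 r v) (WeightedLp p ω) = convSet (WeightedLp p ω) (WienerSpace 1 r v) ∧
    convSet (WeightedLp p ω) (WienerSpace 1 r v) = WeightedLp p ω ∧
    WienerSpace 1 1 v = WeightedLp 1 v ∧
    (0 < d → r < 1 → WienerSpace 1 r v ⊂ WeightedLp 1 v) := by
  have hp0 : p ≠ 0 := (one_pos.trans_le hp1).ne'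
  have hW : ∀ f ∈ WienerSpace 1 r v, MemLp f 1 (weightedMeasure 1 v) := fun f hf =>
    (hv.1.mem_weightedLp_iff one_ne_zero ENNReal.one_ne_top).1
      (wienerSpace_one_one hv ▸ wienerSpace_subset hr0 hr1 hf)
  have hL : ∀ g, g ∈ WeightedLp p ω ↔ MemLp g p (weightedMeasure p ω) := fun g =>
    hω.1.mem_weightedLp_iff hp0 hp.ne
  obtain ⟨c, hc, hmod⟩ := id hωv
  have hcomm : convSet (WienerSpace 1 r v) (WeightedLp p ω) =
      convSet (WeightedLp p ω) (WienerSpace 1 r v) := by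
    ext h
    constructor
    · rintro ⟨f, hf, g, hg, e⟩
      exact ⟨g, hg, f, hf, conv_comm f g ▸ e⟩
    · rintro ⟨g, hg, f, hf, e⟩
      exact ⟨f, hf, g, hg, conv_comm f g ▸ e⟩
  refine ⟨fun f hf g hg => ?_, hcomm, ?_, wienerSpace_one_one hv,
    fun hd hr => wienerSpace_ssubset hd hr0 hr hv⟩
  · filter_upwards [ae_convDefinedAt hc hω.1 hv.1 hmod hp1 hp.ne (hW f hf) ((hL g).1 hg)] with x hx
    exact ⟨hx, convDefinedAt_comm.1 hx⟩
  · rw [← hcomm]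
    refine Set.Subset.antisymm ?_ fun h hh => ?_
    · rintro h ⟨f, hf, g, hg, e⟩
      have hm := memLp_conv hc hω.1 hv.1 hmod hp1 hp.ne (hW f hf) ((hL g).1 hg)
      exact (hL h).2 ((memLp_congr_ae
        (IsWeight.weightedMeasure_absolutelyContinuous.ae_eq e)).2 hm)
    · obtain ⟨f, g, hf, hf0, hg, e⟩ := exists_eq_conv hp1 hp.ne hω.1 hv.1 hωv ((hL h).1 hh)
      exact ⟨f, mem_wienerSpace_of_ae_eq_zero hr0.ne' (hr1.trans_lt ENNReal.one_lt_top).ne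
        hv.1 hf hf0, g, (hL g).2 hg, e⟩
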